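/- Let $q$ and $z$ be independent variables and put $[n]=[n]_q=(q^n-1)/(q-1)$. Let $\beta_n\in\mathbb{Q}(q)$ $(n\ge 0)$ be the $q$-Bernoulli--Carlitz numbers, determined by $$q\sum_{k=0}^{n}\binom nk q^k\beta_k-\beta_n=\begin{cases}q-1,&n=0,\\ 1,&n=1,\\ 0,&n\ge 2,\end{cases}$$ and let $$\beta_n(z)=\sum_{k=0}^n\binom nk z^{n-k}\bigl(1+(q-1)z\bigr)^k\beta_k\in\mathbb{Q}(q)[z]$$ be the $q$-Bernoulli--Carlitz polynomials, that is, $\beta_n(z)=\Psi\bigl((z+(z(q-1)+1)x)^n\bigr)$, where $\Psi$ is the linear form on polynomials in $x$ with $\Psi(x^n)=\beta_n$. Put $$\widehat B_z(x)=\sum_{n\ge 0}\Bigl(\frac1z\int_0^z\beta_n(y)\,dy\Bigr)x^n\in\mathbb{Q}(q)(z)[[x]].$$ Then, as formal power series in $x$ (the convergents of the continued fraction tend to the series in the $x$-adic topology), $$\widehat B_z(x)=\cfrac{1}{[1]+\cfrac{([1]-z)x}{\frac{q+1}{[1]}-\cfrac{([1]+qz)x}{[3]+\cfrac{q([2]-z)x}{\frac{q^2+1}{[2]}-\cfrac{([2]+q^2z)x}{[5]+\cfrac{q^2([3]-z)x}{\frac{q^3+1}{[3]}-\cfrac{([3]+q^3z)x}{\ddots}}}}}}}$$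 where for every $n\ge 1$ the $(2n-1)$-st partial numerator and denominator below the leading $1/[1]$ are $q^{n-1}([n]-z)x$ and $(q^n+1)/[n]$, and the $2n$-th are $-([n]+q^nz)x$ and $[2n+1]$. Equivalently, $$\widehat B_z(x)=\cfrac{1}{1+\cfrac{c_1x}{1+\cfrac{c_2x}{1+\cfrac{c_3x}{\ddots}}}},\qquad c_{2n-1}=\frac{q^{n-1}[n]([n]-z)}{(q^n+1)[2n-1]},\qquad c_{2n}=-\frac{[n]([n]+q^nz)}{(q^n+1)[2n+1]}\qquad(n\ge1).$$ -/

import Mathlib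

noncomputable section

namespace QBernoulli

open Polynomial PowerSeries

/-- The field `ℚ(q)` of rational functions in the variable `q`. -/
abbrev Kq : Type := RatFunc ℚ

/-- The variable `q`. -/
def q : Kq := RatFunc.X

/-- The `q`-integer `[n]_q = (q^n - 1)/(q - 1)`. -/
def qInt (n : ℕ) : Kq := (q ^ n - 1) / (q - 1)

/-- The right-hand side of the relations that define the `q`-Bernoulli-Carlitz numbers. -/
def carlitzRhs (n : ℕ) : Kq := if n = 0 then q - 1 else if n = 1 then 1 else 0

/-- The `q`-Bernoulli-Carlitz numbers `β_n ∈ ℚ(q)`, defined by the umbral relations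
`q (q β + 1)^n - β^n = q - 1, 1, 0, 0, …` for `n = 0, 1, 2, 3, …`, solved for `β_n`
(see `beta_relation` and `beta_unique`). -/
def beta (n : ℕ) : Kq :=
  (carlitzRhs n - q * ∑ k : Fin n, (n.choose k : Kq) * q ^ (k : ℕ) * beta k) / (q ^ (n + 1) - 1)

lemma q_pow_sub_one_ne_zero (n : ℕ) : q ^ (n + 1) - 1 ≠ 0 := by
  have h : (Polynomial.X ^ (n + 1) - Polynomial.C (1 : ℚ)) ≠ 0 :=
    Polynomial.X_pow_sub_C_ne_zero (Nat.succ_pos n) 1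
  have h2 := (RatFunc.algebraMap_ne_zero (K := ℚ) h)
  simpa [q, RatFunc.algebraMap_X] using h2

/-- A sequence satisfies the umbral relations if and only if it satisfies the recursion. -/
lemma umbral_iff (b : ℕ → Kq) (n : ℕ) :
    q * ∑ k ∈ Finset.range (n + 1), (n.choose k : Kq) * q ^ k * b k - b n = carlitzRhs n ↔
      b n = (carlitzRhs n - q * ∑ k : Fin n, (n.choose k : Kq) * q ^ (k : ℕ) * b k) /
        (q ^ (n + 1) - 1) := by
  rw [eq_div_iff (q_pow_sub_one_ne_zero n), Finset.sum_range_succ,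
    Fin.sum_univ_eq_sum_range (fun k => (n.choose k : Kq) * q ^ k * b k) n, Nat.choose_self]
  constructor <;> intro h
  · rw [← h]; push_cast; ring
  · rw [eq_sub_iff_add_eq] at h
    rw [← h]; push_cast; ring

/-- The numbers `β_n` satisfy their defining relations. -/
lemma beta_relation (n : ℕ) :
    q * ∑ k ∈ Finset.range (n + 1), (n.choose k : Kq) * q ^ k * beta k - beta n =
      carlitzRhs n := by
  rw [umbral_iff, ← beta]

/-- The defining relations determine the numbers `β_n`. -/
lemma beta_unique (b : ℕ → Kq)
    (h : ∀ n, q * ∑ k ∈ Finset.range (n + 1), (n.choose k : Kq) * q ^ k * b k - b n =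
      carlitzRhs n) (n : ℕ) : b n = beta n := by
  induction n using Nat.strong_induction_on with
  | _ n ih =>
    rw [(umbral_iff b n).1 (h n), beta]
    congr 3
    exact Finset.sum_congr rfl fun k _ => by rw [ih k k.2]

/-- The linear form `Ψ(x^n) = β_n` on polynomials in `x`, with the scalars extended to
`ℚ(q)[z]`: the variable `z` is the variable of the coefficients. -/
def Psi : Kq[X][X] →ₗ[Kq[X]] Kq[X] :=
  Polynomial.lsum fun n => LinearMap.mulRight Kq[X] (Polynomial.C (beta n))

lemma Psi_X_pow (n : ℕ) : Psi (Polynomial.X ^ n) = Polynomial.C (beta n) := by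
  rw [Psi, Polynomial.X_pow_eq_monomial, Polynomial.lsum_apply,
    Polynomial.sum_monomial_index] <;> simp

/-- The `q`-Bernoulli-Carlitz polynomial `β_n(z) = Ψ((z + (z (q - 1) + 1) x)^n)`,
a polynomial in `z` over `ℚ(q)`. -/
def betaPoly (n : ℕ) : Kq[X] :=
  Psi ((Polynomial.C (Polynomial.X : Kq[X]) +
    Polynomial.C ((Polynomial.X : Kq[X]) * Polynomial.C (q - 1) + 1) * Polynomial.X) ^ n)

/-- The integral `∫_0^z p(y) dy` of a polynomial `p`, as a polynomial in `z`. -/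
def integralZero (p : Kq[X]) : Kq[X] :=
  p.sum fun k a => Polynomial.C (a / ((k : Kq) + 1)) * Polynomial.X ^ (k + 1)

/-- `integralZero p` is the primitive of `p` that vanishes at `0`. -/
lemma integralZero_spec (p : Kq[X]) :
    Polynomial.derivative (integralZero p) = p ∧ (integralZero p).eval 0 = 0 := by
  constructor
  · conv_rhs => rw [← Polynomial.sum_C_mul_X_pow_eq p]
    rw [integralZero, Polynomial.sum, Polynomial.derivative_sum, Polynomial.sum]
    refine Finset.sum_congr rfl fun k _ => ?_
    have hk : (k : Kq) + 1 ≠ 0 := by exact_mod_cast Nat.succ_ne_zero k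
    rw [Polynomial.derivative_C_mul_X_pow]
    push_cast
    rw [div_mul_cancel₀ _ hk]
  · rw [integralZero, Polynomial.sum, Polynomial.eval_finsetSum]
    simp

/-- The field `ℚ(q)(z)` of rational functions in `z` over `ℚ(q)`. -/
abbrev Kqz : Type := RatFunc Kq

/-- The variable `z`. -/
def z : Kqz := RatFunc.X

/-- The moments `(1/z) ∫_0^z β_n(y) dy`. -/
def moment (n : ℕ) : Kqz := 1 / z * algebraMap Kq[X] Kqz (integralZero (betaPoly n))

/-- The generating series `∑_{n ≥ 0} ((1/z) ∫_0^z β_n(y) dy) x^n`. -/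
def Bhat : Kqz⟦X⟧ := PowerSeries.mk moment

/-- An element of `ℚ(q)`, as a constant in `ℚ(q)(z)`. -/
abbrev cst (a : Kq) : Kqz := RatFunc.C a

/-- The formal infinite continued fraction `a 0 / (b 0 + a 1 / (b 1 + a 2 / (b 2 + ⋯)))`. -/
def contFrac {F : Type*} [Field F] (a b : ℕ → LaurentSeries F) :
    GenContFract (LaurentSeries F) where
  h := 0
  s := Stream'.Seq.ofStream fun n => ⟨a n, b n⟩

/-- The power series `f` has the expansion `a 0 / (b 0 + a 1 / (b 1 + a 2 / (b 2 + ⋯)))`: the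
convergents (taken in the field of Laurent series in `x`) tend to `f` in the `x`-adic topology,
that is, for every `N` all but finitely many of them agree with `f` modulo `x^N`. -/
def HasContFracExpansion {F : Type*} [Field F] (f : F⟦X⟧) (a b : ℕ → LaurentSeries F) : Prop :=
  ∀ N : ℤ, ∀ᶠ m in Filter.atTop, ∀ n < N,
    HahnSeries.coeff ((contFrac a b).convs m) n = HahnSeries.coeff (f : LaurentSeries F) n

/-- The monomial `t x` as a Laurent series in `x`. -/
abbrev mulX {F : Type*} [Field F] (t : F) : LaurentSeries F := HahnSeries.single 1 t

/-- The constant `t` as a Laurent series in `x`. -/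
abbrev const {F : Type*} [Field F] (t : F) : LaurentSeries F := HahnSeries.C t

end QBernoulli

end

/-! Let `L` be the linear form `X ^ n ↦ moment n` (`momentForm`). The relations defining `β_n` are a
functional equation for `Psi` under `x ↦ q x + 1` (`Psi_comp`). The substitution `x ↦ z + (z (q - 1)
+ 1) x` commutes with `x ↦ q x + 1`, and after it the right-hand side is the `z`-derivative of `(1 +
(q - 1) z) p(z)`. Integrating from `0` to `z` gives `q L(p(qX + 1)) - L(p) = ((1 + (q - 1) z) p(z) -
p(0)) / z` (`momentForm_comp`).

This equation gives `L` a product formula on `∏ (z - [i] - q^i X)` (`apply_shiftedBasis`). The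
polynomials `A_n`, `B_n` built from the S-fraction coefficients (`orthoPair`) then have product
formulas for `L (A_n * basis_j)` and `L (X * B_n * basis_j)`, both zero for `j < n`
(`apply_orthoPair_mul`). Hence `L` kills `A_n * X ^ k` and `X * B_n * X ^ k` for `k < n`.

The remainders `f Q_m - P_m` of the S-fraction are powers of `x` times the generating series of
these values (`sFracRec_eq_momentSeries`), so `x ^ m` divides the `m`-th one. As `Q_m` has constant
term `1`, the convergent `P_m / Q_m` agrees with `f` modulo `x ^ m`. Rescaling numerators and
denominators gives the other continued fraction. -/

namespace QBernoulli

open Polynomial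
open scoped PowerSeries

noncomputable section

/-! ### Orthogonal polynomials of a form satisfying the functional equation. -/

section Orthogonality

variable {K : Type*} [Field K]

/-- The `q`-bracket in an arbitrary field. -/
def bracket (q : K) (n : ℕ) : K := (q ^ n - 1) / (q - 1)

/-- The coefficients of the S-fraction; `sCoeffOdd n` is the coefficient with index `2n + 1`. -/
def sCoeffOdd (q z : K) (n : ℕ) : K :=
  q ^ n * bracket q (n + 1) * (bracket q (n + 1) - z) /
    ((q ^ (n + 1) + 1) * bracket q (2 * n + 1))

/-- The coefficients of the S-fraction; `sCoeffEven n` is the coefficient with index `2n + 2`. -/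
def sCoeffEven (q z : K) (n : ℕ) : K :=
  -(bracket q (n + 1) * (bracket q (n + 1) + q ^ (n + 1) * z)) /
    ((q ^ (n + 1) + 1) * bracket q (2 * n + 3))

/-- The basis `∏_{i=1}^{j} (z - [i] - q^i X)`. -/
def shiftedBasis (q z : K) : ℕ → K[X]
  | 0 => 1
  | j + 1 => shiftedBasis q z j * (C (z - bracket q (j + 1)) - C (q ^ (j + 1)) * X)

/-- The pair of the `n`-th orthogonal polynomial and the `n`-th kernel polynomial. -/
def orthoPair (q z : K) : ℕ → K[X] × K[X]
  | 0 => (1, 1)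
  | n + 1 =>
    let A := X * (orthoPair q z n).2 + C (sCoeffOdd q z n) * (orthoPair q z n).1
    (A, A + C (sCoeffEven q z n) * (orthoPair q z n).2)

/-- The product `∏_{i=1}^{j} (z - [i])`. -/
def shiftedProd (q z : K) (j : ℕ) : K := ∏ i ∈ Finset.range j, (z - bracket q (i + 1))

/-- The values of the `n`-th orthogonal polynomial against the shifted basis. -/
def orthoValue (q z : K) : ℕ → ℕ → K
  | 0, j => shiftedProd q z j / bracket q (j + 1)
  | n + 1, j => orthoValue q z n j *
      (-(q ^ (n + 1) * bracket q (n + 1)) / ((q ^ (n + 1) + 1) * bracket q (2 * n + 1)) *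
        (bracket q (n + 1) + q ^ (n + 1) * z) * (bracket q j - bracket q n) /
        bracket q (j + n + 2))

/-- The values of `X` times the `n`-th kernel polynomial against the shifted basis. -/
def kernelValue (q z : K) (n j : ℕ) : K :=
  orthoValue q z n j * (q ^ n * bracket q (n + 1) ^ 2 / bracket q (2 * n + 1) *
    (z - bracket q (j + 1)) / bracket q (j + n + 2))

variable {q z : K}

/-- The step from `n` to `n + 1` contributes the factor `[j] - [n]`, which vanishes at `j = n`;
later steps keep the zero. -/
lemma orthoValue_eq_zero {n j : ℕ} (h : j < n) : orthoValue q z n j = 0 := by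
  induction n with
  | zero => omega
  | succ n ih =>
    rw [orthoValue]
    rcases Nat.lt_succ_iff_lt_or_eq.1 h with h | rfl
    · rw [ih h, zero_mul]
    · simp

lemma kernelValue_eq_zero {n j : ℕ} (h : j < n) : kernelValue q z n j = 0 := by
  rw [kernelValue, orthoValue_eq_zero h, zero_mul]

lemma sub_one_ne_zero_of_pow (hq : ∀ n, q ^ (n + 1) - 1 ≠ 0) : q - 1 ≠ 0 := by
  simpa using hq 0

lemma bracket_ne_zero (hq : ∀ n, q ^ (n + 1) - 1 ≠ 0) (n : ℕ) : bracket q (n + 1) ≠ 0 :=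
  div_ne_zero (hq n) (sub_one_ne_zero_of_pow hq)

lemma pow_add_one_ne_zero (hq : ∀ n, q ^ (n + 1) - 1 ≠ 0) (n : ℕ) : q ^ (n + 1) + 1 ≠ 0 := by
  intro h
  apply hq (2 * n + 1)
  linear_combination (q ^ (n + 1) - 1) * h

/-- Needed to compare columns `j` and `j + 1`: with it, all terms of `kernelValue_succ_eq` share the
factor `orthoValue q z n j`. The induction rests on `[j+1] - [n+1] = q ([j] - [n])`. -/
lemma orthoValue_succ_succ (hq : ∀ n, q ^ (n + 1) - 1 ≠ 0) (n j : ℕ) :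
    orthoValue q z (n + 1) (j + 1) = orthoValue q z n j *
      (-(q ^ (n + 1) * bracket q (n + 1)) / ((q ^ (n + 1) + 1) * bracket q (2 * n + 1)) *
        (bracket q (n + 1) + q ^ (n + 1) * z) * (z - bracket q (j + 1)) * q ^ n *
        bracket q (j + 1) ^ 2 / (bracket q (j + n + 2) * bracket q (j + n + 3))) := by
  have h1 := sub_one_ne_zero_of_pow hq
  induction n with
  | zero =>
    have a1 := bracket_ne_zero hq j
    have a2 := bracket_ne_zero hq (j + 1)
    have a3 := bracket_ne_zero hq (j + 2)
    have a4 := bracket_ne_zero hq 0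
    have a5 := pow_add_one_ne_zero hq 0
    have b0 : bracket q 0 = 0 := by simp [bracket]
    simp only [orthoValue, shiftedProd, Finset.prod_range_succ, b0]
    norm_num at *
    field_simp
  | succ n ih =>
    have a2 := bracket_ne_zero hq (j + n + 1)
    have a3 := bracket_ne_zero hq (j + n + 2)
    have a4 := bracket_ne_zero hq (j + n + 3)
    have hs : bracket q (j + 1) - bracket q (n + 1) = q * (bracket q j - bracket q n) := by
      simp only [bracket]; field_simp; ring
    rw [orthoValue, ih, hs, orthoValue]
    have e1 : j + 1 + (n + 1) + 2 = j + n + 3 + 1 := by ring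
    have e2 : j + (n + 1) + 2 = j + n + 2 + 1 := by ring
    have e3 : j + (n + 1) + 3 = j + n + 3 + 1 := by ring
    rw [e1, e2, e3]
    generalize (q ^ (n + 1 + 1) + 1) = x1
    generalize bracket q (2 * (n + 1) + 1) = x2
    generalize (q ^ (n + 1) + 1) = x3
    generalize bracket q (2 * n + 1) = x4
    simp only [div_eq_mul_inv, mul_inv]
    ring

lemma orthoValue_succ_eq (hq : ∀ n, q ^ (n + 1) - 1 ≠ 0) (n j : ℕ) :
    orthoValue q z (n + 1) j =
      kernelValue q z n j + sCoeffOdd q z n * orthoValue q z n j := by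
  have h1 := sub_one_ne_zero_of_pow hq
  rw [orthoValue, kernelValue, mul_comm (sCoeffOdd q z n), ← mul_add]
  congr 1
  have a1 := hq n
  have a2 := hq (2 * n)
  have a3 := hq (j + n + 1)
  have a4 := pow_add_one_ne_zero hq n
  simp only [sCoeffOdd, bracket]
  have e1 : q ^ (2 * n + 1) = q ^ n * q ^ n * q := by ring
  have e2 : q ^ (j + n + 2) = q ^ j * q ^ n * q ^ 2 := by ring
  have e2' : q ^ (j + n + 1 + 1) = q ^ j * q ^ n * q ^ 2 := by ring
  rw [e1] at a2
  rw [e2'] at a3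
  rw [e1, e2]
  simp only [pow_succ q n, pow_succ q j] at *
  generalize q ^ n = N at *
  generalize q ^ j = J at *
  -- The denominators stay atoms while fractions are cleared, so that the nonvanishing hypotheses
  -- apply; `subst` restores them for `ring`.
  generalize h2 : N * N * q - 1 = d2 at a2 ⊢
  generalize h3 : J * N * q ^ 2 - 1 = d3 at a3 ⊢
  field_simp
  subst h2 h3
  ring

/-- Counterpart for the values of `B_{n+1} = A_{n+1} + c_{2n+2} B_n`: multiplication by `X` acts on
the basis through `apply_X_mul_shiftedBasis`. Cancelling a common factor leaves a rational identity
in `q`, `q ^ n`, `q ^ j` and `z`. -/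
lemma kernelValue_succ_eq (hq0 : q ≠ 0) (hq : ∀ n, q ^ (n + 1) - 1 ≠ 0) (n j : ℕ) :
    q ^ (j + 1) * (kernelValue q z (n + 1) j - sCoeffEven q z n * kernelValue q z n j) =
      (z - bracket q (j + 1)) * orthoValue q z (n + 1) j - orthoValue q z (n + 1) (j + 1) := by
  have h1 := sub_one_ne_zero_of_pow hq
  rw [orthoValue_succ_succ hq, kernelValue, kernelValue, orthoValue]
  have key : ∀ T a b c d e r s: K, r * (a * c - s * b) = e * a - d →
      r * (T * a * c - s * (T * b)) = e * (T * a) - T * d := by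
    intro T a b c d e r s h
    linear_combination T * h
  apply key
  have a1 := hq n
  have a2 := hq (2 * n)
  have a2' := hq (2 * n + 2)
  have a3 := hq (j + n + 1)
  have a3' := hq (j + n + 2)
  have a4 := pow_add_one_ne_zero hq n
  simp only [sCoeffEven, bracket]
  have e1 : q ^ (2 * n + 1) = q ^ n * q ^ n * q := by ring
  have e2 : q ^ (j + n + 2) = q ^ j * q ^ n * q ^ 2 := by ring
  have e3 : q ^ (j + n + 3) = q ^ j * q ^ n * q ^ 3 := by ring
  have e4 : q ^ (2 * n + 3) = q ^ n * q ^ n * q ^ 3 := by ring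
  have e5 : q ^ (2 * (n + 1) + 1) = q ^ n * q ^ n * q ^ 3 := by ring
  have e6 : q ^ (j + (n + 1) + 2) = q ^ j * q ^ n * q ^ 3 := by ring
  have e2' : q ^ (j + n + 1 + 1) = q ^ j * q ^ n * q ^ 2 := by ring
  have e3' : q ^ (j + n + 2 + 1) = q ^ j * q ^ n * q ^ 3 := by ring
  have e4' : q ^ (2 * n + 2 + 1) = q ^ n * q ^ n * q ^ 3 := by ring
  rw [e1] at a2
  rw [e2'] at a3
  rw [e3'] at a3'
  rw [e4'] at a2'
  rw [e1, e2, e3, e4, e5, e6]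
  have hN : q ^ n ≠ 0 := pow_ne_zero _ hq0
  have hJ : q ^ j ≠ 0 := pow_ne_zero _ hq0
  simp only [pow_succ q n, pow_succ q j, pow_succ q (n + 1)] at *
  generalize q ^ n = N at *
  generalize q ^ j = J at *
  generalize h2 : N * N * q - 1 = d2 at a2 ⊢
  generalize h2' : N * N * q ^ 3 - 1 = d2' at a2' ⊢
  generalize h3 : J * N * q ^ 2 - 1 = d3 at a3 ⊢
  generalize h3' : J * N * q ^ 3 - 1 = d3' at a3' ⊢
  field_simp
  subst h2 h2' h3 h3'
  ring

lemma pow_mul_X_mul_shiftedBasis (p : K[X]) (j : ℕ) :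
    C (q ^ (j + 1)) * (X * (p * shiftedBasis q z j)) =
      C (z - bracket q (j + 1)) * (p * shiftedBasis q z j) - p * shiftedBasis q z (j + 1) := by
  rw [shiftedBasis]; ring

lemma apply_X_mul_shiftedBasis (L : K[X] →ₗ[K] K) (p : K[X]) (j : ℕ) :
    q ^ (j + 1) * L (X * (p * shiftedBasis q z j)) =
      (z - bracket q (j + 1)) * L (p * shiftedBasis q z j) - L (p * shiftedBasis q z (j + 1)) := by
  have := congrArg L (pow_mul_X_mul_shiftedBasis (q := q) (z := z) p j)
  rw [map_sub, ← smul_eq_C_mul, ← smul_eq_C_mul, map_smul, map_smul] at this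
  exact this

/-- The values of the functional against products of orthogonal polynomials and the basis. -/
lemma apply_orthoPair_mul (hq0 : q ≠ 0) (hq : ∀ n, q ^ (n + 1) - 1 ≠ 0) (L : K[X] →ₗ[K] K)
    (hL : ∀ j, L (shiftedBasis q z j) = shiftedProd q z j / bracket q (j + 1)) (n : ℕ) :
    (∀ j, L ((orthoPair q z n).1 * shiftedBasis q z j) = orthoValue q z n j) ∧
      ∀ j, L (X * ((orthoPair q z n).2 * shiftedBasis q z j)) = kernelValue q z n j := by
  induction n with
  | zero =>
    have h0 : ∀ j, L ((orthoPair q z 0).1 * shiftedBasis q z j) = orthoValue q z 0 j := by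
      intro j; simp [orthoPair, orthoValue, hL]
    refine ⟨h0, fun j => ?_⟩
    have hj : q ^ (j + 1) ≠ 0 := pow_ne_zero _ hq0
    apply mul_left_cancel₀ hj
    rw [apply_X_mul_shiftedBasis]
    change (z - bracket q (j + 1)) * L ((orthoPair q z 0).1 * shiftedBasis q z j) -
      L ((orthoPair q z 0).1 * shiftedBasis q z (j + 1)) = _
    rw [h0, h0, kernelValue, orthoValue, orthoValue, shiftedProd, shiftedProd,
      Finset.prod_range_succ]
    have h1 := sub_one_ne_zero_of_pow hq
    have a1 := hq j
    have a2 := hq (j + 1)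
    simp only [bracket]
    norm_num at *
    field_simp
    ring
  | succ n ih =>
    obtain ⟨ihA, ihB⟩ := ih
    have hA : ∀ j, L ((orthoPair q z (n + 1)).1 * shiftedBasis q z j) =
        orthoValue q z (n + 1) j := by
      intro j
      rw [orthoValue_succ_eq hq, ← ihA, ← ihB, ← smul_eq_mul (sCoeffOdd q z n), ← map_smul,
        ← map_add, smul_eq_C_mul, orthoPair]
      congr 1
      ring
    refine ⟨hA, fun j => ?_⟩
    have hj : q ^ (j + 1) ≠ 0 := pow_ne_zero _ hq0
    have hB : L (X * ((orthoPair q z (n + 1)).2 * shiftedBasis q z j)) =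
        L (X * ((orthoPair q z (n + 1)).1 * shiftedBasis q z j)) +
          sCoeffEven q z n * kernelValue q z n j := by
      rw [← ihB, ← smul_eq_mul (sCoeffEven q z n), ← map_smul, ← map_add, smul_eq_C_mul]
      simp only [orthoPair]
      congr 1
      ring
    have h2 := apply_X_mul_shiftedBasis (q := q) (z := z) L (orthoPair q z (n + 1)).1 j
    rw [hA, hA, ← kernelValue_succ_eq hq0 hq] at h2
    rw [hB, mul_left_cancel₀ hj h2]
    ring

/-- Multiplying a basis element by `X` only involves it and its successor, so each power of `X`
costs one index of vanishing. -/
lemma apply_X_pow_eq_zero (hq0 : q ≠ 0) (L : K[X] →ₗ[K] K) (n : ℕ)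
    (h : ∀ j < n, L (shiftedBasis q z j) = 0) (k : ℕ) (hk : k < n) : L (X ^ k) = 0 := by
  suffices H : ∀ k j, j + k < n → L (X ^ k * shiftedBasis q z j) = 0 by
    simpa [shiftedBasis] using H k 0 (by omega)
  intro k
  induction k with
  | zero => intro j hj; simpa using h j (by omega)
  | succ k ih =>
    intro j hj
    have := apply_X_mul_shiftedBasis (q := q) (z := z) L (X ^ k) j
    rw [ih j (by omega), ih (j + 1) (by omega), mul_zero, sub_zero, ← mul_assoc,
      ← pow_succ'] at this
    exact (mul_eq_zero.1 this).resolve_left (pow_ne_zero _ hq0)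

lemma apply_orthoPair_fst_mul_X_pow (hq0 : q ≠ 0) (hq : ∀ n, q ^ (n + 1) - 1 ≠ 0)
    (L : K[X] →ₗ[K] K)
    (hL : ∀ j, L (shiftedBasis q z j) = shiftedProd q z j / bracket q (j + 1))
    {n k : ℕ} (hk : k < n) : L ((orthoPair q z n).1 * X ^ k) = 0 := by
  refine apply_X_pow_eq_zero (z := z) hq0 (L ∘ₗ LinearMap.mulLeft K (orthoPair q z n).1) n
    (fun j hj => ?_) k hk
  rw [LinearMap.comp_apply, LinearMap.mulLeft_apply, (apply_orthoPair_mul hq0 hq L hL n).1,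
    orthoValue_eq_zero hj]

lemma apply_X_mul_orthoPair_snd_mul_X_pow (hq0 : q ≠ 0) (hq : ∀ n, q ^ (n + 1) - 1 ≠ 0)
    (L : K[X] →ₗ[K] K)
    (hL : ∀ j, L (shiftedBasis q z j) = shiftedProd q z j / bracket q (j + 1))
    {n k : ℕ} (hk : k < n) : L (X * (orthoPair q z n).2 * X ^ k) = 0 := by
  refine apply_X_pow_eq_zero (z := z) hq0 (L ∘ₗ LinearMap.mulLeft K (X * (orthoPair q z n).2)) n
    (fun j hj => ?_) k hk
  rw [LinearMap.comp_apply, LinearMap.mulLeft_apply, mul_assoc,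
    (apply_orthoPair_mul hq0 hq L hL n).2, kernelValue_eq_zero hj]

/-- The functional equation determines the values on the shifted basis. -/
lemma apply_shiftedBasis (hq0 : q ≠ 0) (hz : z ≠ 0) (hq : ∀ n, q ^ (n + 1) - 1 ≠ 0)
    (L : K[X] →ₗ[K] K)
    (hL : ∀ p : K[X], q * L (p.comp (C q * X + 1)) - L p =
      ((1 + (q - 1) * z) * p.eval z - p.eval 0) / z) (j : ℕ) :
    L (shiftedBasis q z j) = shiftedProd q z j / bracket q (j + 1) := by
  have h1 := sub_one_ne_zero_of_pow hq
  induction j with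
  | zero =>
    have := hL 1
    simp only [one_comp, eval_one] at this
    field_simp at this
    have h2 : L 1 = 1 := mul_left_cancel₀ h1 (mul_left_cancel₀ hz (by linear_combination this))
    simp [shiftedBasis, shiftedProd, h2, bracket, h1]
  | succ j ih =>
    -- The factor `z - X` is the missing `i = 0` term, and `X ↦ qX + 1` moves factor `i` to factor
    -- `i + 1`. It also makes the value at `z` vanish, leaving only the value at `0` in the
    -- functional equation.
    have hcomp : ∀ j, ((C z - X) * shiftedBasis q z j).comp (C q * X + 1) =
        shiftedBasis q z (j + 1) := by
      intro j
      induction j with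
      | zero =>
        simp [shiftedBasis, bracket, h1]; ring
      | succ j ih =>
        rw [shiftedBasis, ← mul_assoc, mul_comp, ih]
        conv_rhs => rw [shiftedBasis]
        congr 1
        have : bracket q (j + 1 + 1) = bracket q (j + 1) + q ^ (j + 1) := by
          simp only [bracket]; field_simp; ring
        rw [this]
        simp
        ring
    have heval : ∀ j, (shiftedBasis q z j).eval 0 = shiftedProd q z j := by
      intro j
      induction j with
      | zero => simp [shiftedBasis, shiftedProd]
      | succ j ih => simp [shiftedBasis, ih, shiftedProd, Finset.prod_range_succ]
    have h2 := hL ((C z - X) * shiftedBasis q z j)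
    have h3 := apply_X_mul_shiftedBasis (q := q) (z := z) L 1 j
    rw [one_mul, one_mul] at h3
    rw [hcomp, sub_mul, map_sub, ← smul_eq_C_mul, map_smul, smul_eq_mul] at h2
    simp only [eval_sub, eval_mul, eval_smul, smul_eq_mul, eval_X, heval] at h2
    rw [ih] at h2 h3
    rw [shiftedProd, Finset.prod_range_succ, ← shiftedProd]
    generalize L (X * shiftedBasis q z j) = y at h2 h3
    generalize L (shiftedBasis q z (j + 1)) = v at h2 h3
    generalize shiftedProd q z j = P at *
    have hj : q ^ (j + 1) ≠ 0 := pow_ne_zero _ hq0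
    have a1 := hq j
    have a2 := hq (j + 1)
    have h4 : q * v - (z * (P / bracket q (j + 1)) - y) = - P := by
      rw [h2]; field_simp; ring
    have hb : P / bracket q (j + 1) = P * (q - 1) / (q ^ (j + 1) - 1) := by
      simp only [bracket]; field_simp
    rw [hb] at h3 h4
    -- Eliminating `y = L (X * basis_j)` between `h3` and `h4` leaves one equation for `v`.
    have h5 : (q ^ (j + 1 + 1) - 1) * v = P * (q - 1) * (z - bracket q (j + 1)) := by
      have h6 : (q ^ (j + 1 + 1) - 1) * v = q ^ (j + 1) * (z * (P * (q - 1) / (q ^ (j + 1) - 1)))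
          - q ^ (j + 1) * P
          - (z - bracket q (j + 1)) * (P * (q - 1) / (q ^ (j + 1) - 1)) := by
        linear_combination q ^ (j + 1) * h4 - h3
      rw [h6]
      simp only [bracket]
      field_simp
    rw [bracket.eq_1 q (j + 1 + 1), eq_div_iff (div_ne_zero a2 h1)]
    field_simp
    linear_combination h5

end Orthogonality

/-! ### Convergents and remainders of S-fractions, up to equivalence. -/

section ContinuedFraction

variable {F : Type*} [Field F]

/-- The solution of the three-term recurrence `u (m + 2) = u (m + 1) + c (m + 1) X u m`. -/
def sFracRec (c : ℕ → F) (u₀ u₁ : F⟦X⟧) : ℕ → F⟦X⟧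
  | 0 => u₀
  | 1 => u₁
  | m + 2 => sFracRec c u₀ u₁ (m + 1) +
      PowerSeries.C (c (m + 1)) * PowerSeries.X * sFracRec c u₀ u₁ m

lemma sFracRec_eq_mul_sub (c : ℕ → F) (f : F⟦X⟧) (m : ℕ) :
    sFracRec c f (f - 1) m = f * sFracRec c 1 1 m - sFracRec c 0 1 m := by
  induction m using Nat.twoStepInduction with
  | zero => simp [sFracRec]
  | one => simp [sFracRec]
  | more m h1 h2 => rw [sFracRec, sFracRec, sFracRec, h1, h2]; ring

lemma constantCoeff_sFracRec (c : ℕ → F) (m : ℕ) :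
    PowerSeries.constantCoeff (sFracRec c 1 1 m) = 1 := by
  induction m using Nat.twoStepInduction with
  | zero => simp [sFracRec]
  | one => simp [sFracRec]
  | more m h1 h2 => rw [sFracRec]; simp [h2]

/-- Equivalence transformation: rescaling by `β` multiplies numerator and denominator by the same
product. The shift `m + 1` skips the initial pair `(1, 0)`. -/
lemma contsAux_contFrac (c β : ℕ → F) (a b : ℕ → LaurentSeries F)
    (ha0 : a 0 = const (β 0)) (hb : ∀ n, b n = const (β n))
    (ha : ∀ n, a (n + 1) = mulX (β (n + 1) * β n * c (n + 1))) (m : ℕ) :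
    (contFrac a b).contsAux (m + 1) =
      ⟨const (∏ i ∈ Finset.range m, β i) * (sFracRec c 0 1 m : LaurentSeries F),
        const (∏ i ∈ Finset.range m, β i) * (sFracRec c 1 1 m : LaurentSeries F)⟩ := by
  have hX : ∀ t : F, mulX t = const t * ((PowerSeries.X : F⟦X⟧) : LaurentSeries F) := by
    intro t
    rw [PowerSeries.coe_X, const, HahnSeries.C_apply, HahnSeries.single_mul_single, zero_add,
      mul_one]
  induction m using Nat.twoStepInduction with
  | zero => simp [GenContFract.contsAux, contFrac, sFracRec]
  | one =>
    change GenContFract.nextConts (a 0) (b 0) ⟨1, 0⟩ ⟨0, 1⟩ = _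
    simp [GenContFract.nextConts, GenContFract.nextNum, GenContFract.nextDen, sFracRec, ha0, hb]
  | more m h1 h2 =>
    change GenContFract.nextConts (a (m + 1)) (b (m + 1)) ((contFrac a b).contsAux (m + 1))
      ((contFrac a b).contsAux (m + 1 + 1)) = _
    rw [h1, h2, ha, hb, hX]
    simp only [GenContFract.nextConts, GenContFract.nextNum, GenContFract.nextDen, sFracRec,
      Finset.prod_range_succ, PowerSeries.coe_add, PowerSeries.coe_C,
      map_mul]
    congr 1 <;> ring

/-- A continued fraction equivalent to an S-fraction represents `f` as soon as the remainders of
the S-fraction have increasing order. -/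
theorem hasContFracExpansion_of_X_pow_dvd (f : F⟦X⟧) (c β : ℕ → F) (a b : ℕ → LaurentSeries F)
    (hβ : ∀ n, β n ≠ 0) (ha0 : a 0 = const (β 0)) (hb : ∀ n, b n = const (β n))
    (ha : ∀ n, a (n + 1) = mulX (β (n + 1) * β n * c (n + 1)))
    (hR : ∀ m, PowerSeries.X ^ m ∣ sFracRec c f (f - 1) m) :
    HasContFracExpansion f a b := by
  intro N
  filter_upwards [Filter.eventually_ge_atTop N.toNat] with m hm n hn
  have hc : (contFrac a b).convs m =
      ((f - sFracRec c f (f - 1) m * (sFracRec c 1 1 m)⁻¹ : F⟦X⟧) : LaurentSeries F) := by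
    have hQ : sFracRec c 1 1 m * (sFracRec c 1 1 m)⁻¹ = 1 :=
      PowerSeries.mul_inv_cancel _ (by rw [constantCoeff_sFracRec]; exact one_ne_zero)
    have hQ0 : (sFracRec c 1 1 m : LaurentSeries F) ≠ 0 := by
      intro h
      have := congrArg (fun g : F⟦X⟧ => (g : LaurentSeries F)) hQ
      simp [PowerSeries.coe_mul, h] at this
    have hr : const (∏ i ∈ Finset.range m, β i) ≠ 0 := by
      rw [Ne, _root_.map_eq_zero]
      exact Finset.prod_ne_zero_iff.2 fun i _ => hβ i
    rw [GenContFract.conv_eq_conts_a_div_conts_b, GenContFract.nth_cont_eq_succ_nth_contAux,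
      contsAux_contFrac c β a b ha0 hb ha, mul_div_mul_left _ _ hr, div_eq_iff hQ0,
      ← PowerSeries.coe_mul, sFracRec_eq_mul_sub]
    congr 1
    linear_combination (f * sFracRec c 1 1 m - sFracRec c 0 1 m) * hQ
  rw [hc, PowerSeries.coeff_coe, PowerSeries.coeff_coe]
  split_ifs with h
  · rfl
  · rw [map_sub, PowerSeries.X_pow_dvd_iff.1 (Dvd.dvd.mul_right (hR m) _) _ (by omega), sub_zero]

end ContinuedFraction

/-! ### Remainders as moment series of the orthogonal polynomials. -/

section Remainders

variable {K : Type*} [Field K] {q z : K}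

/-- The generating series of the moments of the functional `p ↦ L (g * p)`. -/
def momentSeries (L : K[X] →ₗ[K] K) (g : K[X]) : K⟦X⟧ :=
  PowerSeries.mk fun k => L (g * X ^ k)

lemma momentSeries_add_C_mul (L : K[X] →ₗ[K] K) (g h : K[X]) (t : K) :
    momentSeries L (g + C t * h) = momentSeries L g + PowerSeries.C t * momentSeries L h := by
  ext k
  simp only [momentSeries, PowerSeries.coeff_mk, map_add, PowerSeries.coeff_C_mul, add_mul,
    ← smul_eq_C_mul, smul_mul_assoc, map_smul, smul_eq_mul]

lemma momentSeries_eq_C_add_X_mul (L : K[X] →ₗ[K] K) (g : K[X]) :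
    momentSeries L g = PowerSeries.C (L g) + PowerSeries.X * momentSeries L (X * g) := by
  ext k
  rcases k with _ | k
  · simp [momentSeries]
  · rw [map_add, PowerSeries.coeff_succ_X_mul, PowerSeries.coeff_C, if_neg k.succ_ne_zero, zero_add,
      momentSeries, momentSeries, PowerSeries.coeff_mk, PowerSeries.coeff_mk]
    congr 1
    ring

/-- The remainders of the S-fraction, in terms of the orthogonal polynomials. -/
lemma sFracRec_eq_momentSeries (hq0 : q ≠ 0) (hq : ∀ n, q ^ (n + 1) - 1 ≠ 0) (L : K[X] →ₗ[K] K)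
    (hL : ∀ j, L (shiftedBasis q z j) = shiftedProd q z j / bracket q (j + 1)) (c : ℕ → K)
    (hc1 : ∀ n, c (2 * n + 1) = sCoeffOdd q z n)
    (hc2 : ∀ n, c (2 * n + 2) = sCoeffEven q z n) (n : ℕ) :
    sFracRec c (momentSeries L 1) (momentSeries L 1 - 1) (2 * n) =
        PowerSeries.X ^ n * momentSeries L (orthoPair q z n).1 ∧
      sFracRec c (momentSeries L 1) (momentSeries L 1 - 1) (2 * n + 1) =
        PowerSeries.X ^ (n + 1) * momentSeries L (X * (orthoPair q z n).2) := by
  induction n with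
  | zero =>
    have h1 : L 1 = 1 := by
      simpa [shiftedBasis, shiftedProd, bracket, sub_one_ne_zero_of_pow hq] using hL 0
    refine ⟨by simp [sFracRec, orthoPair], ?_⟩
    have := momentSeries_eq_C_add_X_mul L 1
    rw [h1, map_one] at this
    simp only [zero_add, sFracRec, orthoPair, pow_one]
    linear_combination this
  | succ n ih =>
    obtain ⟨ihA, ihB⟩ := ih
    have hA : sFracRec c (momentSeries L 1) (momentSeries L 1 - 1) (2 * n + 2) =
        PowerSeries.X ^ (n + 1) * momentSeries L (orthoPair q z (n + 1)).1 := by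
      rw [sFracRec, ihA, ihB, hc1]
      simp only [orthoPair, momentSeries_add_C_mul]
      ring
    refine ⟨hA, ?_⟩
    change sFracRec c _ _ (2 * n + 1 + 2) = _
    -- Orthogonality to `1` removes the constant term, which supplies the extra power of `x` in the
    -- odd remainder.
    have h0 : L (orthoPair q z (n + 1)).1 = 0 := by
      simpa using apply_orthoPair_fst_mul_X_pow hq0 hq L hL (Nat.succ_pos n)
    have h1 : X * (orthoPair q z (n + 1)).2 = X * (orthoPair q z (n + 1)).1 +
        C (sCoeffEven q z n) * (X * (orthoPair q z n).2) := by
      simp only [orthoPair]; ring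
    rw [sFracRec, hA, ihB, hc2, h1, momentSeries_add_C_mul,
      momentSeries_eq_C_add_X_mul L (orthoPair q z (n + 1)).1, h0, map_zero]
    ring

lemma X_pow_dvd_sFracRec (hq0 : q ≠ 0) (hq : ∀ n, q ^ (n + 1) - 1 ≠ 0) (L : K[X] →ₗ[K] K)
    (hL : ∀ j, L (shiftedBasis q z j) = shiftedProd q z j / bracket q (j + 1)) (c : ℕ → K)
    (hc1 : ∀ n, c (2 * n + 1) = sCoeffOdd q z n)
    (hc2 : ∀ n, c (2 * n + 2) = sCoeffEven q z n) (m : ℕ) :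
    PowerSeries.X ^ m ∣ sFracRec c (momentSeries L 1) (momentSeries L 1 - 1) m := by
  have key := sFracRec_eq_momentSeries hq0 hq L hL c hc1 hc2
  obtain ⟨n, rfl | rfl⟩ := m.even_or_odd'
  · rw [(key n).1, two_mul, pow_add]
    refine mul_dvd_mul_left _ (PowerSeries.X_pow_dvd_iff.2 fun k hk => ?_)
    rw [momentSeries, PowerSeries.coeff_mk]
    exact apply_orthoPair_fst_mul_X_pow hq0 hq L hL hk
  · rw [(key n).2, show 2 * n + 1 = n + 1 + n by ring, pow_add]
    refine mul_dvd_mul_left _ (PowerSeries.X_pow_dvd_iff.2 fun k hk => ?_)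
    rw [momentSeries, PowerSeries.coeff_mk]
    exact apply_X_mul_orthoPair_snd_mul_X_pow hq0 hq L hL hk

end Remainders

/-! ### The functional equation of the moment form. -/

lemma integralZero_unique {p F : Kq[X]} (h : derivative F = p) (h0 : F.eval 0 = 0) :
    integralZero p = F := by
  obtain ⟨h1, h2⟩ := integralZero_spec p
  have hd : derivative (integralZero p - F) = 0 := by rw [derivative_sub, h1, h, sub_self]
  have hC := eq_C_of_derivative_eq_zero hd
  have hv := congrArg (eval 0) hC
  rw [eval_sub, h2, h0, sub_self, eval_C] at hv
  rw [← hv, C_0] at hC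
  exact sub_eq_zero.1 hC

lemma integralZero_add (p r : Kq[X]) :
    integralZero (p + r) = integralZero p + integralZero r :=
  integralZero_unique (by rw [derivative_add, (integralZero_spec p).1, (integralZero_spec r).1])
    (by rw [eval_add, (integralZero_spec p).2, (integralZero_spec r).2, add_zero])

lemma integralZero_C_mul (a : Kq) (p : Kq[X]) :
    integralZero (C a * p) = C a * integralZero p :=
  integralZero_unique (by rw [derivative_C_mul, (integralZero_spec p).1])
    (by rw [eval_mul, (integralZero_spec p).2, mul_zero])

lemma Psi_C_mul (a : Kq[X]) (H : Kq[X][X]) : Psi (C a * H) = a * Psi H := by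
  rw [← smul_eq_C_mul, map_smul, smul_eq_mul]

/-- The defining relations of the numbers `β_n`, as a functional equation of `Psi`. -/
lemma Psi_comp (H : Kq[X][X]) :
    C q * Psi (H.comp (C (C q) * X + 1)) - Psi H =
      C (q - 1) * H.eval 0 + (derivative H).eval 0 := by
  induction H using Polynomial.induction_on' with
  | add p r hp hr =>
    simp only [add_comp, map_add, eval_add]
    linear_combination hp + hr
  | monomial n a =>
    have hn : C q * Psi ((C (C q) * X + 1) ^ n) - Psi (X ^ n) = C (carlitzRhs n) := by
      rw [← beta_relation n, add_pow, map_sum, Psi_X_pow]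
      simp only [map_sub, map_mul, map_sum]
      congr 2
      refine Finset.sum_congr rfl fun k _ => ?_
      rw [one_pow, mul_one, mul_pow, ← C_pow, ← C_pow, mul_assoc, Psi_C_mul, ← C_eq_natCast,
        mul_comm (X ^ k), Psi_C_mul, Psi_X_pow, map_natCast]
      ring
    rw [← C_mul_X_pow_eq_monomial, mul_comp, C_comp, X_pow_comp, Psi_C_mul, Psi_C_mul]
    have : C q * (a * Psi ((C (C q) * X + 1) ^ n)) - a * Psi (X ^ n) = a * C (carlitzRhs n) := by
      rw [← hn]; ring
    rw [this, derivative_C_mul_X_pow, carlitzRhs]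
    rcases n with _ | _ | n
    · simp; ring
    · simp
    · simp

/-- The substitution `x ↦ z + (z (q - 1) + 1) x`. -/
def umbralSubst (P : Kq[X]) : Kq[X][X] :=
  (P.map C).comp (C (X : Kq[X]) + C ((X : Kq[X]) * C (q - 1) + 1) * X)

lemma umbralSubst_comp (P : Kq[X]) :
    umbralSubst (P.comp (C q * X + 1)) = (umbralSubst P).comp (C (C q) * X + 1) := by
  rw [umbralSubst, umbralSubst, map_comp, comp_assoc, comp_assoc]
  congr 1
  simp only [Polynomial.map_add, Polynomial.map_mul, map_C, map_X, Polynomial.map_one, add_comp,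
    mul_comp, sub_comp, C_comp, X_comp, one_comp, map_add, map_mul, map_sub, map_one]
  ring

/-- By `Psi_comp` and the chain rule, the right-hand side is `(q - 1) P(z) + (1 + (q - 1) z) P'(z)`,
an exact derivative. -/
lemma Psi_umbralSubst_comp (P : Kq[X]) :
    C q * Psi (umbralSubst (P.comp (C q * X + 1))) - Psi (umbralSubst P) =
      derivative ((1 + C (q - 1) * X) * P) := by
  have h : (P.map C).eval (X : Kq[X]) = P := by rw [eval_map, eval₂_C_X]
  have h' : ((derivative P).map C).eval (X : Kq[X]) = derivative P := by rw [eval_map, eval₂_C_X]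
  have hd : derivative (C (X : Kq[X]) + C ((X : Kq[X]) * C (q - 1) + 1) * X) =
      C ((X : Kq[X]) * C (q - 1) + 1) := by
    rw [derivative_add, derivative_C, derivative_C_mul, derivative_X, zero_add, mul_one]
  have hd' : derivative ((1 : Kq[X]) + C (q - 1) * X) = C (q - 1) := by
    rw [derivative_add, derivative_one, derivative_C_mul, derivative_X, zero_add, mul_one]
  rw [umbralSubst_comp, Psi_comp, umbralSubst, derivative_comp, derivative_map, eval_comp,
    eval_mul, eval_comp, hd, derivative_mul, hd']
  simp only [eval_add, eval_mul, eval_C, eval_X, mul_zero, add_zero, h, h']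
  ring

/-- The linear form `x^n ↦ moment n`. -/
def momentForm : Kqz[X] →ₗ[Kqz] Kqz :=
  Polynomial.lsum fun n => LinearMap.mulRight Kqz (moment n)

lemma momentForm_X_pow (n : ℕ) : momentForm (X ^ n) = moment n := by
  rw [momentForm, X_pow_eq_monomial, lsum_apply, sum_monomial_index] <;> simp

lemma momentForm_map (P : Kq[X]) :
    momentForm (P.map (RatFunc.C : Kq →+* Kqz)) =
      1 / z * algebraMap Kq[X] Kqz (integralZero (Psi (umbralSubst P))) := by
  induction P using Polynomial.induction_on' with
  | add p r hp hr =>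
    have : umbralSubst (p + r) = umbralSubst p + umbralSubst r := by
      simp [umbralSubst]
    rw [Polynomial.map_add, map_add, hp, hr, this, map_add, integralZero_add, map_add, mul_add]
  | monomial n a =>
    have : umbralSubst (monomial n a) = C (C a) * umbralSubst (X ^ n) := by
      simp [umbralSubst, ← C_mul_X_pow_eq_monomial]
    have hb : Psi (umbralSubst (X ^ n)) = betaPoly n := by
      rw [umbralSubst, Polynomial.map_pow, map_X, X_pow_comp, betaPoly]
    rw [this, Psi_C_mul, hb, integralZero_C_mul, map_mul, map_monomial, ← C_mul_X_pow_eq_monomial,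
      ← smul_eq_C_mul, map_smul, momentForm_X_pow, moment, smul_eq_mul, RatFunc.algebraMap_C]
    ring

lemma eval_map_z (P : Kq[X]) :
    (P.map (RatFunc.C : Kq →+* Kqz)).eval z = algebraMap Kq[X] Kqz P := by
  induction P using Polynomial.induction_on' with
  | add p r hp hr => rw [Polynomial.map_add, eval_add, hp, hr, map_add]
  | monomial n a =>
    rw [← C_mul_X_pow_eq_monomial]
    simp [RatFunc.algebraMap_C, RatFunc.algebraMap_X, z]

lemma momentForm_comp_map (P : Kq[X]) :
    cst q * momentForm ((P.map (RatFunc.C : Kq →+* Kqz)).comp (C (cst q) * X + 1)) -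
        momentForm (P.map (RatFunc.C : Kq →+* Kqz)) =
      ((1 + (cst q - 1) * z) * (P.map (RatFunc.C : Kq →+* Kqz)).eval z -
        (P.map (RatFunc.C : Kq →+* Kqz)).eval 0) / z := by
  -- The exact derivative is integrated from `0`; the primitive vanishing there brings in `P(0)`.
  have hi : C q * integralZero (Psi (umbralSubst (P.comp (C q * X + 1)))) -
      integralZero (Psi (umbralSubst P)) = (1 + C (q - 1) * X) * P - C (P.eval 0) := by
    have h := integralZero_unique (F := (1 + C (q - 1) * X) * P - C (P.eval 0))
      (by rw [derivative_sub, derivative_C, sub_zero]) (by simp)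
    rw [← h, ← Psi_umbralSubst_comp, ← integralZero_C_mul, eq_comm, eq_sub_iff_add_eq,
      ← integralZero_add, sub_add_cancel]
  have hc : (P.map (RatFunc.C : Kq →+* Kqz)).comp (C (cst q) * X + 1) =
      (P.comp (C q * X + 1)).map (RatFunc.C : Kq →+* Kqz) := by
    simp [map_comp]
  have h0 : (P.map (RatFunc.C : Kq →+* Kqz)).eval 0 = cst (P.eval 0) := by
    rw [← map_zero (RatFunc.C : Kq →+* Kqz), eval_map_apply]
  rw [hc, momentForm_map, momentForm_map, eval_map_z, h0]
  have := congrArg (algebraMap Kq[X] Kqz) hi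
  simp only [map_sub, map_mul, map_add, map_one, RatFunc.algebraMap_C, RatFunc.algebraMap_X]
    at this
  rw [show (RatFunc.X : Kqz) = z from rfl] at this
  rw [div_eq_mul_one_div _ z, ← this]
  ring

/-- Both sides are linear over `ℚ(q)(z)`, so monomials, which have coefficients in `ℚ(q)`, suffice.
-/
lemma momentForm_comp (p : Kqz[X]) :
    cst q * momentForm (p.comp (C (cst q) * X + 1)) - momentForm p =
      ((1 + (cst q - 1) * z) * p.eval z - p.eval 0) / z := by
  induction p using Polynomial.induction_on' with
  | add p r hp hr =>
    simp only [add_comp, map_add, eval_add]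
    linear_combination hp + hr
  | monomial n a =>
    have h := momentForm_comp_map (X ^ n)
    rw [Polynomial.map_pow, map_X] at h
    rw [← C_mul_X_pow_eq_monomial, ← smul_eq_C_mul, smul_comp, map_smul, map_smul, eval_smul,
      eval_smul]
    simp only [smul_eq_mul]
    linear_combination a * h

lemma cst_q_pow_sub_one_ne_zero (n : ℕ) : cst q ^ (n + 1) - 1 ≠ 0 := by
  have h : cst (q ^ (n + 1) - 1) ≠ 0 :=
    (_root_.map_ne_zero (RatFunc.C : Kq →+* Kqz)).2 (q_pow_sub_one_ne_zero n)
  simpa only [cst, map_sub, map_pow, map_one] using h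

lemma cst_q_ne_zero : cst q ≠ 0 :=
  (_root_.map_ne_zero (RatFunc.C : Kq →+* Kqz)).2 RatFunc.X_ne_zero

lemma cst_qInt (n : ℕ) : cst (qInt n) = bracket (cst q) n := by
  simp only [cst, qInt, bracket, map_div₀, map_sub, map_pow, map_one]

lemma momentForm_shiftedBasis (j : ℕ) :
    momentForm (shiftedBasis (cst q) z j) = shiftedProd (cst q) z j / bracket (cst q) (j + 1) :=
  apply_shiftedBasis cst_q_ne_zero RatFunc.X_ne_zero cst_q_pow_sub_one_ne_zero momentForm
    momentForm_comp j

lemma momentSeries_momentForm_one : momentSeries momentForm 1 = Bhat := by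
  ext k
  rw [momentSeries, Bhat, PowerSeries.coeff_mk, PowerSeries.coeff_mk, one_mul, momentForm_X_pow]

/-- Every continued fraction equivalent to the S-fraction with coefficients `sCoeffOdd` and
`sCoeffEven` represents `Bhat`. -/
theorem hasContFracExpansion_Bhat (c β : ℕ → Kqz) (a b : ℕ → LaurentSeries Kqz)
    (hc1 : ∀ n, c (2 * n + 1) = sCoeffOdd (cst q) z n)
    (hc2 : ∀ n, c (2 * n + 2) = sCoeffEven (cst q) z n)
    (hβ : ∀ n, β n ≠ 0) (ha0 : a 0 = const (β 0)) (hb : ∀ n, b n = const (β n))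
    (ha : ∀ n, a (n + 1) = mulX (β (n + 1) * β n * c (n + 1))) :
    HasContFracExpansion Bhat a b := by
  refine hasContFracExpansion_of_X_pow_dvd Bhat c β a b hβ ha0 hb ha fun m => ?_
  rw [← momentSeries_momentForm_one]
  exact X_pow_dvd_sFracRec cst_q_ne_zero cst_q_pow_sub_one_ne_zero momentForm
    momentForm_shiftedBasis c hc1 hc2 m

/-! ### Matching the coefficients of the two continued fractions. -/

/-- The coefficients of the S-fraction in one sequence, indexed from `1`. -/
def sCoeff (m : ℕ) : Kqz :=
  -- At `m = 0` truncated subtraction gives a junk value; `sFracRec` reads its coefficients only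
  -- from index `1` on.
  if Even m then sCoeffEven (cst q) z (m / 2 - 1) else sCoeffOdd (cst q) z (m / 2)

lemma sCoeff_odd (n : ℕ) : sCoeff (2 * n + 1) = sCoeffOdd (cst q) z n := by
  rw [sCoeff, if_neg (by simp), show (2 * n + 1) / 2 = n by omega]

lemma sCoeff_even (n : ℕ) : sCoeff (2 * n + 2) = sCoeffEven (cst q) z n := by
  rw [sCoeff, if_pos ⟨n + 1, by ring⟩, show (2 * n + 2) / 2 - 1 = n by omega]

/-- The partial denominators of the equivalent continued fraction. -/
def partDen (m : ℕ) : Kqz :=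
  if Even m then bracket (cst q) (m + 1)
  else (cst q ^ (m / 2 + 1) + 1) / bracket (cst q) (m / 2 + 1)

lemma partDen_odd (n : ℕ) :
    partDen (2 * n + 1) = (cst q ^ (n + 1) + 1) / bracket (cst q) (n + 1) := by
  rw [partDen, if_neg (by simp), show (2 * n + 1) / 2 = n by omega]

lemma partDen_even (n : ℕ) : partDen (2 * n) = bracket (cst q) (2 * n + 1) := by
  rw [partDen, if_pos (by simp)]

lemma partDen_ne_zero (m : ℕ) : partDen m ≠ 0 := by
  obtain ⟨n, rfl | rfl⟩ := m.even_or_odd'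
  · rw [partDen_even]
    exact bracket_ne_zero cst_q_pow_sub_one_ne_zero _
  · rw [partDen_odd]
    exact div_ne_zero (pow_add_one_ne_zero cst_q_pow_sub_one_ne_zero _)
      (bracket_ne_zero cst_q_pow_sub_one_ne_zero _)

lemma partDen_mul_sCoeff_odd (n : ℕ) :
    partDen (2 * n + 1) * partDen (2 * n) * sCoeff (2 * n + 1) =
      cst q ^ n * (bracket (cst q) (n + 1) - z) := by
  rw [partDen_odd, partDen_even, sCoeff_odd, sCoeffOdd]
  have h1 := bracket_ne_zero cst_q_pow_sub_one_ne_zero n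
  have h2 := bracket_ne_zero cst_q_pow_sub_one_ne_zero (2 * n)
  have h3 := pow_add_one_ne_zero cst_q_pow_sub_one_ne_zero n
  generalize cst q ^ (n + 1) + 1 = d at *
  generalize bracket (cst q) (n + 1) = d1 at *
  generalize bracket (cst q) (2 * n + 1) = d2 at *
  field_simp

lemma partDen_mul_sCoeff_even (n : ℕ) :
    partDen (2 * n + 2) * partDen (2 * n + 1) * sCoeff (2 * n + 2) =
      -(bracket (cst q) (n + 1) + cst q ^ (n + 1) * z) := by
  rw [partDen_odd, show 2 * n + 2 = 2 * (n + 1) by ring, partDen_even,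
    show 2 * (n + 1) = 2 * n + 2 by ring, sCoeff_even, sCoeffEven]
  have h1 := bracket_ne_zero cst_q_pow_sub_one_ne_zero n
  have h2 := bracket_ne_zero cst_q_pow_sub_one_ne_zero (2 * n + 2)
  have h3 := pow_add_one_ne_zero cst_q_pow_sub_one_ne_zero n
  generalize cst q ^ (n + 1) = e at *
  generalize hd : e + 1 = d at *
  generalize bracket (cst q) (n + 1) = d1 at *
  generalize bracket (cst q) (2 * n + 2 + 1) = d2 at *
  field_simp

end

end QBernoulli

theorem mainTheorem9 :
    -- the continued fraction with partial numerators `a n` and partial denominators `b n`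
    (∀ a b : ℕ → LaurentSeries QBernoulli.Kqz,
      a 0 = 1 →
      b 0 = QBernoulli.const (QBernoulli.cst (QBernoulli.qInt 1)) →
      (∀ n : ℕ, 1 ≤ n →
        a (2 * n - 1) = QBernoulli.mulX (QBernoulli.cst (QBernoulli.q ^ (n - 1)) *
          (QBernoulli.cst (QBernoulli.qInt n) - QBernoulli.z)) ∧
        b (2 * n - 1) = QBernoulli.const (QBernoulli.cst
          ((QBernoulli.q ^ n + 1) / QBernoulli.qInt n)) ∧
        a (2 * n) = -QBernoulli.mulX (QBernoulli.cst (QBernoulli.qInt n) +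
          QBernoulli.cst (QBernoulli.q ^ n) * QBernoulli.z) ∧
        b (2 * n) = QBernoulli.const (QBernoulli.cst (QBernoulli.qInt (2 * n + 1)))) →
      QBernoulli.HasContFracExpansion QBernoulli.Bhat a b) ∧
    -- the S-fraction `1 / (1 + c 1 x / (1 + c 2 x / (1 + ⋯)))`
    (∀ c : ℕ → QBernoulli.Kqz,
      (∀ n : ℕ, 1 ≤ n →
        c (2 * n - 1) = QBernoulli.cst (QBernoulli.q ^ (n - 1)) *
            QBernoulli.cst (QBernoulli.qInt n) *
            (QBernoulli.cst (QBernoulli.qInt n) - QBernoulli.z) /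
          QBernoulli.cst ((QBernoulli.q ^ n + 1) * QBernoulli.qInt (2 * n - 1)) ∧
        c (2 * n) = -(QBernoulli.cst (QBernoulli.qInt n) *
            (QBernoulli.cst (QBernoulli.qInt n) +
              QBernoulli.cst (QBernoulli.q ^ n) * QBernoulli.z)) /
          QBernoulli.cst ((QBernoulli.q ^ n + 1) * QBernoulli.qInt (2 * n + 1))) →
      QBernoulli.HasContFracExpansion QBernoulli.Bhat
        (fun n => if n = 0 then 1 else QBernoulli.mulX (c n)) (fun _ => 1)) := by
  open QBernoulli in
  constructor
  · intro a b ha0 hb0 h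
    refine hasContFracExpansion_Bhat sCoeff partDen a b sCoeff_odd sCoeff_even partDen_ne_zero
      ?_ ?_ ?_
    -- The leading numerator `1` equals `partDen 0` because `[1] = 1`.
    · rw [ha0, show 0 = 2 * 0 from rfl, partDen_even, ← cst_qInt]
      simp [qInt, div_self (show q - 1 ≠ 0 by simpa using q_pow_sub_one_ne_zero 0)]
    · intro m
      obtain ⟨n, rfl | rfl⟩ := m.even_or_odd'
      · rw [partDen_even, ← cst_qInt]
        rcases n with _ | n
        · exact hb0
        · exact (h (n + 1) (by omega)).2.2.2
      · rw [partDen_odd, ← cst_qInt]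
        have := (h (n + 1) (by omega)).2.1
        rw [show 2 * (n + 1) - 1 = 2 * n + 1 by omega] at this
        rw [this, cst, map_div₀, map_add, map_pow, map_one]
    · intro m
      obtain ⟨n, rfl | rfl⟩ := m.even_or_odd'
      · rw [partDen_mul_sCoeff_odd, ← cst_qInt]
        have := (h (n + 1) (by omega)).1
        rw [show 2 * (n + 1) - 1 = 2 * n + 1 by omega, Nat.add_sub_cancel] at this
        rw [this, cst, map_pow]
      · rw [show 2 * n + 1 + 1 = 2 * n + 2 from rfl, partDen_mul_sCoeff_even, ← cst_qInt, mulX,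
          HahnSeries.single_neg, ← map_pow]
        exact (h (n + 1) (by omega)).2.2.1
  · intro c h
    -- The S-fraction is the case of trivial rescaling, `β = 1`.
    refine hasContFracExpansion_Bhat c 1 _ _ (fun n => ?_) (fun n => ?_) (fun _ => one_ne_zero)
      ?_ ?_ ?_
    · have := (h (n + 1) (by omega)).1
      rw [show 2 * (n + 1) - 1 = 2 * n + 1 by omega, Nat.add_sub_cancel] at this
      rw [this, sCoeffOdd, ← cst_qInt, ← cst_qInt]
      simp only [map_mul, map_add, map_pow, map_one]
    · have := (h (n + 1) (by omega)).2
      rw [show 2 * (n + 1) = 2 * n + 2 by omega] at this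
      rw [this, sCoeffEven, ← cst_qInt, ← cst_qInt]
      simp only [map_mul, map_add, map_pow, map_one]
    · simp
    · simp
    · simp
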